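/- Let $\Omega\subset\mathbb{R}^d$, $d\ge 1$, be a bounded open set (for example a bounded Lipschitz domain), let $V:=H^1_0(\Omega)$ be the closure of $C_c^\infty(\Omega)$ in $H^1(\Omega)$ and $H(\mathrm{div},\Omega):=\{\tau\in[L^2(\Omega)]^d:\ \mathrm{div}\,\tau\in L^2(\Omega)\}$. Write $(\cdot,\cdot)$ and $\|\cdot\|$ for the inner product and norm of $L^2(\Omega)$ and of $[L^2(\Omega)]^d$. Let $\nu$ be measurable with $0<\underline{\nu}\le\nu\le\overline{\nu}$ a.e. in $\Omega$, where $\underline\nu,\overline\nu$ are constants, let $y_d,u_d,f\in L^2(\Omega)$ and $\lambda>0$, and let $C_F>0$ be a constant in the Friedrichs inequality, i.e. $\|w\|\le C_F\|\nabla w\|$ for all $w\in V$. Consider the unconstrained optimal control problem: minimize $$\mathcal J(y,v)=\tfrac12\|y-y_d\|^2+\tfrac{\lambda}{2}\|v-u_d\|^2$$ over all $v\in L^2(\Omega)$ and $y\in V$ such that $(\nu\nabla y,\nabla w)=(f+v,w)$ for all $w\in V$. Its optimality system for $(y,u,p)\in V\times L^2(\Omega)\times V$ is $$(\nu\nabla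 y,\nabla w)=(f+u,w),\qquad (\nu\nabla p,\nabla w)=(y-y_d,w)\quad\text{for all } w\in V,\qquad p+\lambda(u-u_d)=0 .$$ For $\alpha,\beta>0$, $\eta,\zeta\in V$ and $\tau,\rho\in H(\mathrm{div},\Omega)$ put $r:=f+u_d-\tfrac1\lambda\zeta+\mathrm{div}\,\tau$ and $$\mathcal J^\oplus(\alpha,\beta;\eta,\zeta,\tau)=\tfrac{1+\alpha}{2}\|\eta-y_d\|^2+\tfrac{(1+\alpha)(1+\beta)C_F^2}{2\alpha\underline\nu^2}\|\tau-\nu\nabla\eta\|^2+\tfrac{(1+\alpha)(1+\beta)C_F^4}{2\alpha\beta\underline\nu^2}\|r\|^2+\tfrac1{2\lambda}\|\zeta\|^2,$$ $$\begin{aligned}\mathcal J^\ominus(\eta,\zeta,\tau,\rho)={}&\tfrac12\|\eta-y_d\|^2+\tfrac1{2\lambda}\|\zeta\|^2+(r,\zeta)+(\tau-\nu\nabla\eta,\nabla\zeta)\\&-\tfrac1{\underline\nu}\bigl(C_F\|\eta-y_d+\mathrm{div}\,\rho\|+\|\rho-\nu\nabla\zeta\|\bigr)\\&\times\Bigl(\tfrac{C_F^3}{\lambda\underline\nu}\|\eta-y_d+\mathrm{div}\,\rho\|+\tfrac{C_F^2}{\lambda\underline\nu}\|\rho-\nu\nabla\zeta\|+C_F\|r\|+\|\tau-\nu\nabla\eta\|\Bigr),\end{aligned}$$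 $$\mathcal M^\oplus(\alpha,\beta;\eta,\zeta,\tau,\rho)=\mathcal J^\oplus(\alpha,\beta;\eta,\zeta,\tau)-\mathcal J^\ominus(\eta,\zeta,\tau,\rho).$$ Then: 1. $\displaystyle\inf_{\eta,\zeta\in V,\ \tau,\rho\in H(\mathrm{div},\Omega),\ \alpha,\beta>0}\mathcal M^\oplus(\alpha,\beta;\eta,\zeta,\tau,\rho)=0.$ 2. The optimality system has exactly one solution $(y,u,p)$; and a pair $(y,u)$ solves the optimal control problem if and only if $(y,u,p)$ solves the optimality system for some $p\in V$. 3. For this exact solution, $u=u_d-\tfrac1\lambda p$, the fluxes $\nu\nabla y$ and $\nu\nabla p$ belong to $H(\mathrm{div},\Omega)$, and the infimum is approached at the exact state, adjoint state and fluxes as $\alpha\to0$: for every $\beta>0$, $$\lim_{\alpha\to0^+}\mathcal M^\oplus(\alpha,\beta;y,p,\nu\nabla y,\nu\nabla p)=0 .$$ -/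

import Mathlib

open MeasureTheory Set Filter Topology
open scoped ContDiff

namespace EllipticControl

/-- The space `ℝ^d` with its Euclidean norm. -/
abbrev Space (d : ℕ) : Type := EuclideanSpace ℝ (Fin d)

/-- `L²(Ω)`. -/
noncomputable abbrev L2 {d : ℕ} (Ω : Set (Space d)) : Type :=
  Lp ℝ 2 (volume.restrict Ω)

/-- `[L²(Ω)]^d`. -/
noncomputable abbrev L2Vec {d : ℕ} (Ω : Set (Space d)) : Type :=
  Lp (Space d) 2 (volume.restrict Ω)

/-- `φ ∈ C_c^∞(Ω)`. -/
structure IsTestFunction {d : ℕ} (Ω : Set (Space d)) (φ : Space d → ℝ) : Prop where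
  smooth : ContDiff ℝ ∞ φ
  compact : HasCompactSupport φ
  support : tsupport φ ⊆ Ω

/-- `g` is the weak (distributional) gradient of `w` in `Ω`. -/
def IsWeakGradient {d : ℕ} (Ω : Set (Space d)) (w : L2 Ω) (g : L2Vec Ω) : Prop :=
  ∀ φ : Space d → ℝ, IsTestFunction Ω φ → ∀ i : Fin d,
    ∫ x in Ω, w x * fderiv ℝ φ x (EuclideanSpace.single i 1) = -∫ x in Ω, g x i * φ x

/-- `q` is the weak (distributional) divergence of the vector field `τ` in `Ω`. -/
def IsWeakDivergence {d : ℕ} (Ω : Set (Space d)) (τ : L2Vec Ω) (q : L2 Ω) : Prop :=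
  ∀ φ : Space d → ℝ, IsTestFunction Ω φ →
    ∫ x in Ω, inner ℝ (τ x) (gradient φ x) = -∫ x in Ω, q x * φ x

theorem IsTestFunction.zero {d : ℕ} (Ω : Set (Space d)) :
    IsTestFunction Ω (fun _ => (0 : ℝ)) := by
  have h0 : tsupport (fun _ : Space d => (0 : ℝ)) = ∅ := by
    rw [tsupport_eq_empty_iff]; rfl
  exact ⟨contDiff_const, by rw [HasCompactSupport, h0]; exact isCompact_empty,
    by rw [h0]; exact empty_subset _⟩

theorem IsTestFunction.add {d : ℕ} {Ω : Set (Space d)} {φ ψ : Space d → ℝ}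
    (hφ : IsTestFunction Ω φ) (hψ : IsTestFunction Ω ψ) :
    IsTestFunction Ω (fun x => φ x + ψ x) :=
  ⟨hφ.smooth.add hψ.smooth, hφ.compact.add hψ.compact,
    (tsupport_add φ ψ).trans (union_subset hφ.support hψ.support)⟩

theorem IsTestFunction.const_mul {d : ℕ} {Ω : Set (Space d)} {φ : Space d → ℝ}
    (hφ : IsTestFunction Ω φ) (c : ℝ) : IsTestFunction Ω (fun x => c * φ x) :=
  ⟨contDiff_const.mul hφ.smooth, hφ.compact.mul_left,
    (closure_mono (Function.support_const_smul_subset c φ)).trans hφ.support⟩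

theorem IsTestFunction.differentiable {d : ℕ} {Ω : Set (Space d)} {φ : Space d → ℝ}
    (hφ : IsTestFunction Ω φ) : Differentiable ℝ φ :=
  hφ.smooth.differentiable (by simp)

/-- The space of all pairs `(φ, ∇φ)` with `φ ∈ C_c^∞(Ω)`, inside `L²(Ω) × [L²(Ω)]^d`, which carries
the norm `(‖w‖² + ‖g‖²)^(1/2)`. -/
noncomputable def testPairs {d : ℕ} (Ω : Set (Space d)) :
    Submodule ℝ (WithLp 2 (L2 Ω × L2Vec Ω)) where
  carrier := {z | ∃ φ : Space d → ℝ, IsTestFunction Ω φ ∧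
    z.fst =ᵐ[volume.restrict Ω] φ ∧ z.snd =ᵐ[volume.restrict Ω] gradient φ}
  zero_mem' := by
    refine ⟨fun _ => 0, IsTestFunction.zero Ω, ?_, ?_⟩
    · exact Lp.coeFn_zero _ _ _
    · have : gradient (fun _ : Space d => (0 : ℝ)) = 0 := by
        funext x; simp [gradient]
      rw [this]
      exact Lp.coeFn_zero _ _ _
  add_mem' := by
    rintro a b ⟨φ, hφ, h1, h2⟩ ⟨ψ, hψ, h3, h4⟩
    refine ⟨fun x => φ x + ψ x, hφ.add hψ, ?_, ?_⟩
    · refine (Lp.coeFn_add a.fst b.fst).trans ?_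
      filter_upwards [h1, h3] with x hx hy
      simp [hx, hy]
    · refine (Lp.coeFn_add a.snd b.snd).trans ?_
      filter_upwards [h2, h4] with x hx hy
      simp only [Pi.add_apply, hx, hy, gradient]
      rw [fderiv_fun_add (hφ.differentiable x) (hψ.differentiable x), map_add]
  smul_mem' := by
    rintro c a ⟨φ, hφ, h1, h2⟩
    refine ⟨fun x => c * φ x, hφ.const_mul c, ?_, ?_⟩
    · refine (Lp.coeFn_smul c a.fst).trans ?_
      filter_upwards [h1] with x hx
      simp [hx]
    · refine (Lp.coeFn_smul c a.snd).trans ?_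
      filter_upwards [h2] with x hx
      simp only [Pi.smul_apply, hx, gradient]
      rw [fderiv_const_mul (hφ.differentiable x), map_smul]

/-- The closure of `C_c^∞(Ω)` in the `H¹` norm, as a closed subspace of `L²(Ω) × [L²(Ω)]^d`. -/
noncomputable def h10Submodule {d : ℕ} (Ω : Set (Space d)) :
    Submodule ℝ (WithLp 2 (L2 Ω × L2Vec Ω)) :=
  (testPairs Ω).topologicalClosure

/-- `V = H¹₀(Ω)`, the closure of `C_c^∞(Ω)` in the `H¹` norm. A function `w ∈ H¹₀(Ω)` is
represented by the pair `(w, ∇w)`. -/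
noncomputable abbrev H10 {d : ℕ} (Ω : Set (Space d)) : Type :=
  ↥(h10Submodule Ω)

namespace H10

variable {d : ℕ} {Ω : Set (Space d)}

/-- The function `w ∈ L²(Ω)` underlying an element of `H¹₀(Ω)`. -/
noncomputable def fn (w : H10 Ω) : L2 Ω := w.1.fst

/-- The gradient `∇w ∈ [L²(Ω)]^d` of an element of `H¹₀(Ω)`. -/
noncomputable def grad (w : H10 Ω) : L2Vec Ω := w.1.snd

end H10

/-- `H(div,Ω)`: vector fields in `[L²(Ω)]^d` with weak divergence in `L²(Ω)`. A field
`τ ∈ H(div,Ω)` is represented by the pair `(τ, div τ)`. -/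
def Hdiv {d : ℕ} (Ω : Set (Space d)) : Type :=
  {z : L2Vec Ω × L2 Ω // IsWeakDivergence Ω z.1 z.2}

namespace Hdiv

variable {d : ℕ} {Ω : Set (Space d)}

/-- The vector field `τ`. -/
noncomputable def field (τ : Hdiv Ω) : L2Vec Ω := τ.1.1

/-- The divergence `div τ`. -/
noncomputable def div (τ : Hdiv Ω) : L2 Ω := τ.1.2

end Hdiv

/-- `ν` is a measurable diffusion coefficient on `Ω` with `0 < νlo ≤ ν ≤ νhi` a.e. in `Ω`. -/
structure IsDiffusion {d : ℕ} (Ω : Set (Space d)) (ν : Space d → ℝ) (νlo νhi : ℝ) : Prop where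
  measurable : AEMeasurable ν (volume.restrict Ω)
  pos : 0 < νlo
  lower : ∀ᵐ x ∂(volume.restrict Ω), νlo ≤ ν x
  upper : ∀ᵐ x ∂(volume.restrict Ω), ν x ≤ νhi

theorem IsDiffusion.memLp_smul {d : ℕ} {Ω : Set (Space d)} {ν : Space d → ℝ} {νlo νhi : ℝ}
    (hν : IsDiffusion Ω ν νlo νhi) (g : L2Vec Ω) :
    MemLp (fun x => ν x • g x) 2 (volume.restrict Ω) := by
  refine (Lp.memLp g).of_le_mul (c := νhi)
    (hν.measurable.aestronglyMeasurable.smul (Lp.aestronglyMeasurable g)) ?_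
  filter_upwards [hν.lower, hν.upper] with x h1 h2
  rw [norm_smul, Real.norm_eq_abs, abs_of_nonneg (hν.pos.le.trans h1)]
  gcongr

/-- The vector field `ν g ∈ [L²(Ω)]^d`. -/
noncomputable def flux {d : ℕ} {Ω : Set (Space d)} {ν : Space d → ℝ} {νlo νhi : ℝ}
    (hν : IsDiffusion Ω ν νlo νhi) (g : L2Vec Ω) : L2Vec Ω :=
  (hν.memLp_smul g).toLp

/-- `C` is a constant in the Friedrichs inequality `‖w‖ ≤ C ‖∇w‖` on `H¹₀(Ω)`. -/
def IsFriedrichsConstant {d : ℕ} (Ω : Set (Space d)) (C : ℝ) : Prop :=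
  0 < C ∧ ∀ w : H10 Ω, ‖w.fn‖ ≤ C * ‖w.grad‖

theorem continuous_fn {d : ℕ} (Ω : Set (Space d)) :
    Continuous (fun z : WithLp 2 (L2 Ω × L2Vec Ω) => z.fst) :=
  continuous_fst.comp (WithLp.prod_continuous_ofLp 2 _ _)

theorem continuous_grad {d : ℕ} (Ω : Set (Space d)) :
    Continuous (fun z : WithLp 2 (L2 Ω × L2Vec Ω) => z.snd) :=
  continuous_snd.comp (WithLp.prod_continuous_ofLp 2 _ _)

theorem IsTestFunction.continuous_partial {d : ℕ} {Ω : Set (Space d)} {φ : Space d → ℝ}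
    (hφ : IsTestFunction Ω φ) (v : Space d) : Continuous (fun x => fderiv ℝ φ x v) :=
  (hφ.smooth.continuous_fderiv (by simp)).clm_apply continuous_const

theorem IsTestFunction.compact_partial {d : ℕ} {Ω : Set (Space d)} {φ : Space d → ℝ}
    (hφ : IsTestFunction Ω φ) (v : Space d) : HasCompactSupport (fun x => fderiv ℝ φ x v) :=
  hφ.compact.fderiv_apply (𝕜 := ℝ) v

/-- The second component of an element of `H¹₀(Ω)` is the weak gradient of the first one. -/
theorem H10.isWeakGradient {d : ℕ} {Ω : Set (Space d)} (w : H10 Ω) :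
    IsWeakGradient Ω w.fn w.grad := by
  intro φ hφ i
  have hA : MemLp (fun x => fderiv ℝ φ x (EuclideanSpace.single i 1)) 2
      (volume.restrict Ω) :=
    (hφ.continuous_partial _).memLp_of_hasCompactSupport (hφ.compact_partial _)
  have hB : MemLp (fun x => φ x • (EuclideanSpace.single i 1 : Space d)) 2
      (volume.restrict Ω) :=
    (hφ.smooth.continuous.smul continuous_const).memLp_of_hasCompactSupport
      hφ.compact.smul_right
  have e1 : ∀ z : L2 Ω, ∫ x in Ω, z x * fderiv ℝ φ x (EuclideanSpace.single i 1)
      = inner ℝ hA.toLp z := by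
    intro z
    rw [L2.inner_def]
    refine integral_congr_ae ?_
    filter_upwards [hA.coeFn_toLp] with x hx
    rw [hx]
    simp
  have e2 : ∀ z : L2Vec Ω, ∫ x in Ω, z x i * φ x = inner ℝ hB.toLp z := by
    intro z
    rw [L2.inner_def]
    refine integral_congr_ae ?_
    filter_upwards [hB.coeFn_toLp] with x hx
    rw [hx, real_inner_smul_left, EuclideanSpace.inner_single_left]
    simp [mul_comm]
  have hcl : IsClosed {z : WithLp 2 (L2 Ω × L2Vec Ω) |
      inner ℝ hA.toLp z.fst = -inner ℝ hB.toLp z.snd} := by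
    refine isClosed_eq ?_ ?_
    · exact continuous_const.inner (continuous_fn Ω)
    · exact (continuous_const.inner (continuous_grad Ω)).neg
  rw [e1, e2]
  refine closure_minimal ?_ hcl w.2
  rintro z ⟨ψ, hψ, h1, h2⟩
  change inner ℝ hA.toLp z.fst = -inner ℝ hB.toLp z.snd
  rw [← e1, ← e2]
  have s1 : ∫ x in Ω, z.fst x * fderiv ℝ φ x (EuclideanSpace.single i 1)
      = ∫ x, ψ x * fderiv ℝ φ x (EuclideanSpace.single i 1) := by
    refine Eq.trans ?_ (setIntegral_eq_integral_of_forall_compl_eq_zero (s := Ω) ?_)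
    · refine integral_congr_ae ?_
      filter_upwards [h1] with x hx
      rw [hx]
    · intro x hx
      rw [image_eq_zero_of_notMem_tsupport (fun h => hx (hψ.support h)), zero_mul]
  have s2 : ∫ x in Ω, z.snd x i * φ x
      = ∫ x, fderiv ℝ ψ x (EuclideanSpace.single i 1) * φ x := by
    refine Eq.trans ?_ (setIntegral_eq_integral_of_forall_compl_eq_zero (s := Ω) ?_)
    · refine integral_congr_ae ?_
      filter_upwards [h2] with x hx
      have h3 : gradient ψ x i = fderiv ℝ ψ x (EuclideanSpace.single i 1) := by
        rw [← inner_gradient_left, EuclideanSpace.inner_single_right]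
        simp
      rw [hx, h3]
    · intro x hx
      rw [image_eq_zero_of_notMem_tsupport (fun h => hx (hφ.support h)), mul_zero]
  rw [s1, s2]
  refine integral_mul_fderiv_eq_neg_fderiv_mul_of_integrable ?_ ?_ ?_ ?_ ?_
  · exact ((hψ.continuous_partial _).mul hφ.smooth.continuous).integrable_of_hasCompactSupport
      hφ.compact.mul_left
  · exact (hψ.smooth.continuous.mul (hφ.continuous_partial _)).integrable_of_hasCompactSupport
      hψ.compact.mul_right
  · exact (hψ.smooth.continuous.mul hφ.smooth.continuous).integrable_of_hasCompactSupport
      hφ.compact.mul_left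
  · intro x _; exact hψ.differentiable x
  · intro x _; exact hφ.differentiable x

/-- A bounded set in `ℝ^d`, `d ≥ 1`, has a Friedrichs constant. -/
theorem exists_isFriedrichsConstant {d : ℕ} (hd : 1 ≤ d) {Ω : Set (Space d)}
    (hΩ : Bornology.IsBounded Ω) : ∃ C : ℝ, IsFriedrichsConstant Ω C := by
  obtain ⟨R, hR0, hR⟩ := hΩ.exists_pos_norm_le
  refine ⟨2 * R, by positivity, ?_⟩
  have hcl : IsClosed {z : WithLp 2 (L2 Ω × L2Vec Ω) | ‖z.fst‖ ≤ 2 * R * ‖z.snd‖} :=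
    isClosed_le (continuous_fn Ω).norm
      (continuous_const.mul (continuous_grad Ω).norm)
  intro w
  refine closure_minimal ?_ hcl w.2
  rintro z ⟨φ, hφ, h1, h2⟩
  change ‖z.fst‖ ≤ 2 * R * ‖z.snd‖
  let i : Fin d := ⟨0, hd⟩
  let e : Space d := EuclideanSpace.single i 1
  let D : Space d → ℝ := fun x => fderiv ℝ φ x e
  have hDc : Continuous D := hφ.continuous_partial e
  have hφc := hφ.smooth.continuous
  have hxc : Continuous (fun x : Space d => x i) := by fun_prop
  have hgc : Continuous (gradient φ) :=
    (LinearIsometryEquiv.continuous _).comp (hφ.smooth.continuous_fderiv (by simp))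
  have hgs : HasCompactSupport (gradient φ) := by
    exact (hφ.compact.fderiv (𝕜 := ℝ)).comp_left
      (g := (InnerProductSpace.toDual ℝ (Space d)).symm) (map_zero _)
  have hDg : ∀ x, |D x| ≤ ‖gradient φ x‖ := by
    intro x
    have : D x = inner ℝ (gradient φ x) e := inner_gradient_left.symm
    rw [this]
    refine (abs_real_inner_le_norm _ _).trans ?_
    simp [e]
  have hfd : ∀ x, fderiv ℝ (fun y : Space d => φ y * φ y) x e = 2 * (φ x * D x) := by
    intro x
    rw [fderiv_fun_mul (hφ.differentiable x) (hφ.differentiable x)]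
    simp [D]; ring
  have hxd : ∀ x, fderiv ℝ (fun y : Space d => y i) x e = 1 := by
    intro x
    have : HasFDerivAt (fun y : Space d => y i) (EuclideanSpace.proj i : Space d →L[ℝ] ℝ) x :=
      (EuclideanSpace.proj i : Space d →L[ℝ] ℝ).hasFDerivAt
    rw [this.fderiv]; simp [e]
  have ibp := integral_mul_fderiv_eq_neg_fderiv_mul_of_integrable (μ := (volume : Measure (Space d)))
    (f := fun y : Space d => φ y * φ y) (g := fun y : Space d => y i) (v := e)
    (by
      simp only [hfd]
      exact ((continuous_const.mul (hφc.mul hDc)).mul hxc).integrable_of_hasCompactSupport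
        (hφ.compact.mul_right.mul_left.mul_right))
    (by
      simp only [hxd]
      exact ((hφc.mul hφc).mul continuous_const).integrable_of_hasCompactSupport
        (hφ.compact.mul_right.mul_right))
    (((hφc.mul hφc).mul hxc).integrable_of_hasCompactSupport (hφ.compact.mul_right.mul_right))
    (fun x _ => (hφ.differentiable x).mul (hφ.differentiable x))
    (fun x _ => (EuclideanSpace.proj i : Space d →L[ℝ] ℝ).differentiableAt)
  simp only [hfd, hxd, mul_one] at ibp
  rw [← integral_neg] at ibp
  have hI1 : Integrable (fun x => φ x * φ x) :=
    (hφc.mul hφc).integrable_of_hasCompactSupport hφ.compact.mul_right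
  have hI2 : Integrable (fun x => ‖gradient φ x‖ * ‖gradient φ x‖) :=
    (hgc.norm.mul hgc.norm).integrable_of_hasCompactSupport hgs.norm.mul_right
  have hle : ∫ x, φ x * φ x ≤ ∫ x, (1 / 2 * (φ x * φ x)
      + 2 * R ^ 2 * (‖gradient φ x‖ * ‖gradient φ x‖)) := by
    rw [ibp]
    refine integral_mono ?_ ((hI1.const_mul _).add (hI2.const_mul _)) ?_
    · exact ((continuous_const.mul (hφc.mul hDc)).mul hxc).neg.integrable_of_hasCompactSupport
        (hφ.compact.mul_right.mul_left.mul_right.neg)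
    · intro x
      simp only
      by_cases hx : x ∈ Ω
      · have hxi : |x i| ≤ R := by
          have := PiLp.norm_apply_le x i
          rw [Real.norm_eq_abs] at this
          exact this.trans (hR x hx)
        have hb : |D x * x i| ≤ R * ‖gradient φ x‖ := by
          rw [abs_mul, mul_comm]
          exact mul_le_mul hxi (hDg x) (abs_nonneg _) hR0.le
        have hsq : (D x * x i) ^ 2 ≤ (R * ‖gradient φ x‖) ^ 2 := by
          rw [← sq_abs]; gcongr
        nlinarith [sq_nonneg (φ x + 2 * (D x * x i))]
      · have : φ x = 0 := image_eq_zero_of_notMem_tsupport (fun h => hx (hφ.support h))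
        rw [this]
        have := mul_nonneg (norm_nonneg (gradient φ x)) (norm_nonneg (gradient φ x))
        simp only [zero_mul, mul_zero, neg_zero, zero_add]
        positivity
  rw [integral_add (hI1.const_mul _) (hI2.const_mul _), integral_const_mul,
    integral_const_mul] at hle
  have n1 : ‖z.fst‖ ^ 2 = ∫ x, φ x * φ x := by
    rw [← real_inner_self_eq_norm_sq, L2.inner_def]
    refine Eq.trans ?_ (setIntegral_eq_integral_of_forall_compl_eq_zero (s := Ω) ?_)
    · refine integral_congr_ae ?_
      filter_upwards [h1] with x hx
      rw [hx]; simp [sq]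
    · intro x hx
      rw [image_eq_zero_of_notMem_tsupport (fun h => hx (hφ.support h)), zero_mul]
  have n2 : ‖z.snd‖ ^ 2 = ∫ x, ‖gradient φ x‖ * ‖gradient φ x‖ := by
    rw [← real_inner_self_eq_norm_sq, L2.inner_def]
    refine Eq.trans ?_ (setIntegral_eq_integral_of_forall_compl_eq_zero (s := Ω) ?_)
    · refine integral_congr_ae ?_
      filter_upwards [h2] with x hx
      rw [hx, real_inner_self_eq_norm_sq]; ring
    · intro x hx
      have h0 : fderiv ℝ φ x = 0 :=
        image_eq_zero_of_notMem_tsupport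
          (fun h => hx (hφ.support (tsupport_fderiv_subset ℝ h)))
      simp [gradient, h0]
  rw [← n1, ← n2] at hle
  refine (sq_le_sq₀ (norm_nonneg _) ?_).1 ?_
  · positivity
  nlinarith

section Problem

variable {d : ℕ} {Ω : Set (Space d)} {ν : Space d → ℝ} {νlo νhi : ℝ}

/-- `y ∈ H¹₀(Ω)` is the weak solution of `-div (ν ∇y) = r`. -/
def IsWeakSolution (hν : IsDiffusion Ω ν νlo νhi) (r : L2 Ω) (y : H10 Ω) : Prop :=
  ∀ w : H10 Ω, inner ℝ (flux hν y.grad) w.grad = inner ℝ r w.fn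

/-- The cost functional `𝒥(y, v)`. -/
noncomputable def cost (yd ud : L2 Ω) (lam : ℝ) (y : H10 Ω) (v : L2 Ω) : ℝ :=
  1 / 2 * ‖y.fn - yd‖ ^ 2 + lam / 2 * ‖v - ud‖ ^ 2

/-- `(y, u)` solves the unconstrained optimal control problem: `y` is the state of `u`, and the cost
of `(y, u)` is minimal among all controls `v ∈ L²(Ω)` and their states. -/
def IsOptimal (hν : IsDiffusion Ω ν νlo νhi) (yd ud f : L2 Ω) (lam : ℝ)
    (y : H10 Ω) (u : L2 Ω) : Prop :=
  IsWeakSolution hν (f + u) y ∧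
    ∀ (z : H10 Ω) (v : L2 Ω), IsWeakSolution hν (f + v) z →
      cost yd ud lam y u ≤ cost yd ud lam z v

/-- The optimality system: state equation, adjoint equation, and `p + λ (u - u_d) = 0`. -/
structure SolvesOptimalitySystem (hν : IsDiffusion Ω ν νlo νhi) (yd ud f : L2 Ω) (lam : ℝ)
    (y : H10 Ω) (u : L2 Ω) (p : H10 Ω) : Prop where
  state : IsWeakSolution hν (f + u) y
  adjoint : IsWeakSolution hν (y.fn - yd) p
  control : p.fn + lam • (u - ud) = 0

/-- The majorant `𝒥⊕(α, β; η, ζ, τ)` of the cost functional in the unconstrained case. -/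
noncomputable def costMajorant (hν : IsDiffusion Ω ν νlo νhi) (CF : ℝ) (yd ud f : L2 Ω) (lam : ℝ)
    (α β : ℝ) (η ζ : H10 Ω) (τ : Hdiv Ω) : ℝ :=
  (1 + α) / 2 * ‖η.fn - yd‖ ^ 2
    + (1 + α) * (1 + β) * CF ^ 2 / (2 * α * νlo ^ 2) * ‖τ.field - flux hν η.grad‖ ^ 2
    + (1 + α) * (1 + β) * CF ^ 4 / (2 * α * β * νlo ^ 2)
      * ‖f + ud - (1 / lam) • ζ.fn + τ.div‖ ^ 2
    + 1 / (2 * lam) * ‖ζ.fn‖ ^ 2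

/-- The minorant `𝒥⊖(η, ζ, τ, ρ)` of the cost functional in the unconstrained case. -/
noncomputable def costMinorant (hν : IsDiffusion Ω ν νlo νhi) (CF : ℝ) (yd ud f : L2 Ω) (lam : ℝ)
    (η ζ : H10 Ω) (τ ρ : Hdiv Ω) : ℝ :=
  1 / 2 * ‖η.fn - yd‖ ^ 2 + 1 / (2 * lam) * ‖ζ.fn‖ ^ 2
    + inner ℝ (f + ud - (1 / lam) • ζ.fn + τ.div) ζ.fn
    + inner ℝ (τ.field - flux hν η.grad) ζ.grad
    - 1 / νlo * (CF * ‖η.fn - yd + ρ.div‖ + ‖ρ.field - flux hν ζ.grad‖)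
      * (CF ^ 3 / (lam * νlo) * ‖η.fn - yd + ρ.div‖
        + CF ^ 2 / (lam * νlo) * ‖ρ.field - flux hν ζ.grad‖
        + CF * ‖f + ud - (1 / lam) • ζ.fn + τ.div‖
        + ‖τ.field - flux hν η.grad‖)

/-- The error majorant `ℳ⊕(α, β; η, ζ, τ, ρ) = 𝒥⊕(α, β; η, ζ, τ) - 𝒥⊖(η, ζ, τ, ρ)`. -/
noncomputable def errorMajorant (hν : IsDiffusion Ω ν νlo νhi) (CF : ℝ) (yd ud f : L2 Ω)
    (lam : ℝ) (α β : ℝ) (η ζ : H10 Ω) (τ ρ : Hdiv Ω) : ℝ :=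
  costMajorant hν CF yd ud f lam α β η ζ τ - costMinorant hν CF yd ud f lam η ζ τ ρ

end Problem

end EllipticControl

namespace EllipticControl

/-! The optimal cost lies between the two functionals. The control `ud - ζ/λ` is admissible, so its
cost is at least optimal, and a residual estimate for its state followed by two Young inequalities
bounds that cost by the majorant (`cost_le_majorant`).

From below, the optimal cost is expanded around `(η, ζ)`. The squares are dropped, and the remaining
first-order term is the residual of the adjoint equation evaluated at `e = y - η`. It is bounded by
the dual norm of that residual times the size of `∇e` (`System.minorant_le_cost`). Hence the
difference is nonnegative. At the exact solution and its fluxes every residual vanishes and only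
`α/2 ‖y - yd‖²` is left, which tends to zero with `α` (`System.majorant_sub_minorant`).

Existence comes from Lax–Milgram, once for the state equation and once for the reduced equation of
the control. Uniqueness and the equivalence with the control problem follow from the quadratic
growth of the cost (`System.cost_eq`). All this uses only two Hilbert space maps, a symmetric
coercive operator and Friedrichs' inequality, hence the abstract triple. -/

/-- An abstract symmetric elliptic problem: a map `toFn`, a gradient `grad`, a symmetric coercive
coefficient `coeff` with lower bound `lo`, and a Friedrichs inequality with constant `CF`. -/
structure EllipticTriple (V L G : Type*)
    [NormedAddCommGroup V] [InnerProductSpace ℝ V]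
    [NormedAddCommGroup L] [InnerProductSpace ℝ L]
    [NormedAddCommGroup G] [InnerProductSpace ℝ G] where
  toFn : V →L[ℝ] L
  grad : V →L[ℝ] G
  coeff : G →L[ℝ] G
  lo : ℝ
  CF : ℝ
  lo_pos : 0 < lo
  CF_pos : 0 < CF
  symm : ∀ g h, inner ℝ (coeff g) h = inner ℝ g (coeff h)
  coercive : ∀ g, lo * ‖g‖ ^ 2 ≤ inner ℝ (coeff g) g
  friedrichs : ∀ w, ‖toFn w‖ ≤ CF * ‖grad w‖
  norm_sq : ∀ w, ‖w‖ ^ 2 = ‖toFn w‖ ^ 2 + ‖grad w‖ ^ 2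

namespace EllipticTriple

variable {V L G : Type*}
  [NormedAddCommGroup V] [InnerProductSpace ℝ V]
  [NormedAddCommGroup L] [InnerProductSpace ℝ L]
  [NormedAddCommGroup G] [InnerProductSpace ℝ G] (E : EllipticTriple V L G)

/-- The weak formulation of `-div (ν ∇y) = r`. -/
def IsSol (r : L) (y : V) : Prop :=
  ∀ w : V, inner ℝ (E.coeff (E.grad y)) (E.grad w) = inner ℝ r (E.toFn w)

/-- `q` is the divergence of `t`, tested against all of `V`. -/
def IsDiv (t : G) (q : L) : Prop :=
  ∀ w : V, inner ℝ t (E.grad w) = -inner ℝ q (E.toFn w)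

/-! ### Energy estimates, uniqueness and coercivity -/

theorem energy_symm (y w : V) :
    inner ℝ (E.coeff (E.grad y)) (E.grad w) = inner ℝ (E.coeff (E.grad w)) (E.grad y) := by
  rw [E.symm, real_inner_comm]

theorem eq_zero_of_grad {w : V} (h : E.grad w = 0) : w = 0 := by
  have h1 := E.friedrichs w
  have h2 := E.norm_sq w
  rw [h, norm_zero, mul_zero] at h1
  rw [le_antisymm h1 (norm_nonneg _), h] at h2
  simpa using h2

/-- Coercivity gives a quadratic lower bound, from which one factor `‖∇e‖` cancels; `hK` covers the
case where it is zero. -/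
theorem grad_le {e : V} {K : ℝ}
    (h : inner ℝ (E.coeff (E.grad e)) (E.grad e) ≤ K * ‖E.grad e‖) (hK : 0 ≤ K) :
    E.lo * ‖E.grad e‖ ≤ K := by
  rcases (norm_nonneg (E.grad e)).eq_or_lt with h0 | h0
  · rw [← h0, mul_zero]; exact hK
  · have := (E.coercive (E.grad e)).trans h
    exact le_of_mul_le_mul_right (by linarith) h0

/-- Cauchy–Schwarz and Friedrichs: a computable bound for the dual norm of a residual functional. -/
theorem pairing_le (q : L) (s : G) (w : V) :
    inner ℝ q (E.toFn w) + inner ℝ s (E.grad w) ≤ (E.CF * ‖q‖ + ‖s‖) * ‖E.grad w‖ := by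
  have h1 := real_inner_le_norm q (E.toFn w)
  have h2 := real_inner_le_norm s (E.grad w)
  have h3 := mul_le_mul_of_nonneg_left (E.friedrichs w) (norm_nonneg q)
  linarith

variable {E} in
theorem IsSol.sub {r r' : L} {y y' : V} (h : E.IsSol r y) (h' : E.IsSol r' y') :
    E.IsSol (r - r') (y - y') := by
  intro w
  rw [map_sub, map_sub, inner_sub_left, inner_sub_left, h w, h' w]

variable {E} in
theorem IsSol.unique {r : L} {y y' : V} (h : E.IsSol r y) (h' : E.IsSol r y') : y = y' := by
  have h1 := (h.sub h') (y - y')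
  rw [sub_self, inner_zero_left] at h1
  have h2 := E.grad_le (e := y - y') (K := 0) (by rw [h1, zero_mul]) le_rfl
  have h3 : ‖E.grad (y - y')‖ ≤ 0 := by
    by_contra! h4
    exact absurd h2 (not_le.2 (mul_pos E.lo_pos h4))
  exact sub_eq_zero.1 (E.eq_zero_of_grad (norm_le_zero_iff.1 h3))

/-- The bilinear form `(ν ∇y, ∇w)`. -/
noncomputable def form : V →L[ℝ] V →L[ℝ] ℝ :=
  (innerSL ℝ).bilinearComp (E.coeff.comp E.grad) E.grad

theorem form_apply (y w : V) :
    E.form y w = inner ℝ (E.coeff (E.grad y)) (E.grad w) := rfl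

theorem isCoercive_form : IsCoercive E.form := by
  have hp : 0 < E.CF ^ 2 + 1 := by positivity
  refine ⟨E.lo / (E.CF ^ 2 + 1), div_pos E.lo_pos hp, fun w => ?_⟩
  rw [form_apply]
  refine le_trans ?_ (E.coercive _)
  have h1 : ‖w‖ ^ 2 ≤ (E.CF ^ 2 + 1) * ‖E.grad w‖ ^ 2 := by
    have := pow_le_pow_left₀ (norm_nonneg _) (E.friedrichs w) 2
    rw [E.norm_sq]; linarith [mul_pow E.CF ‖E.grad w‖ 2]
  rw [mul_assoc, ← sq, div_mul_eq_mul_div, div_le_iff₀ hp]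
  nlinarith [mul_le_mul_of_nonneg_left h1 E.lo_pos.le]

/-! ### The optimality system, the cost and its two bounds -/

/-- The optimality system. -/
structure System (yd ud f : L) (lam : ℝ) (y : V) (u : L) (p : V) : Prop where
  state : E.IsSol (f + u) y
  adjoint : E.IsSol (E.toFn y - yd) p
  control : E.toFn p + lam • (u - ud) = 0

/-- The cost functional. -/
noncomputable def cost (yd ud : L) (lam : ℝ) (y : V) (v : L) : ℝ :=
  1 / 2 * ‖E.toFn y - yd‖ ^ 2 + lam / 2 * ‖v - ud‖ ^ 2

/-- The majorant of the cost functional, for a flux `t` with divergence `q`. -/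
noncomputable def majorant (yd ud f : L) (lam α β : ℝ) (η ζ : V) (t : G) (q : L) : ℝ :=
  (1 + α) / 2 * ‖E.toFn η - yd‖ ^ 2
    + (1 + α) * (1 + β) * E.CF ^ 2 / (2 * α * E.lo ^ 2) * ‖t - E.coeff (E.grad η)‖ ^ 2
    + (1 + α) * (1 + β) * E.CF ^ 4 / (2 * α * β * E.lo ^ 2)
      * ‖f + ud - (1 / lam) • E.toFn ζ + q‖ ^ 2
    + 1 / (2 * lam) * ‖E.toFn ζ‖ ^ 2

/-- The minorant of the cost functional, for fluxes `t`, `t'` with divergences `q`, `q'`. -/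
noncomputable def minorant (yd ud f : L) (lam : ℝ) (η ζ : V) (t : G) (q : L) (t' : G) (q' : L) :
    ℝ :=
  1 / 2 * ‖E.toFn η - yd‖ ^ 2 + 1 / (2 * lam) * ‖E.toFn ζ‖ ^ 2
    + inner ℝ (f + ud - (1 / lam) • E.toFn ζ + q) (E.toFn ζ)
    + inner ℝ (t - E.coeff (E.grad η)) (E.grad ζ)
    - 1 / E.lo * (E.CF * ‖E.toFn η - yd + q'‖ + ‖t' - E.coeff (E.grad ζ)‖)
      * (E.CF ^ 3 / (lam * E.lo) * ‖E.toFn η - yd + q'‖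
        + E.CF ^ 2 / (lam * E.lo) * ‖t' - E.coeff (E.grad ζ)‖
        + E.CF * ‖f + ud - (1 / lam) • E.toFn ζ + q‖
        + ‖t - E.coeff (E.grad η)‖)

theorem grad_le_of_residual {e : V} {r : L} {s : G}
    (h : ∀ w, inner ℝ (E.coeff (E.grad e)) (E.grad w)
      = inner ℝ r (E.toFn w) + inner ℝ s (E.grad w)) :
    E.lo * ‖E.grad e‖ ≤ E.CF * ‖r‖ + ‖s‖ :=
  E.grad_le ((h e).trans_le (E.pairing_le r s e))
    (add_nonneg (mul_nonneg E.CF_pos.le (norm_nonneg _)) (norm_nonneg _))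

variable {E} in
-- Inserting an arbitrary flux `t` splits the error equation into an equilibrium residual and a flux
-- residual.
theorem IsSol.residual {g q : L} {y : V} {t : G} (h : E.IsSol g y) (ht : E.IsDiv t q) (η w : V) :
    inner ℝ (E.coeff (E.grad (y - η))) (E.grad w)
      = inner ℝ (g + q) (E.toFn w) + inner ℝ (t - E.coeff (E.grad η)) (E.grad w) := by
  rw [map_sub, map_sub, inner_sub_left, inner_sub_left, inner_add_left, h w, ht w]
  ring

variable {E} in
theorem System.control_eq {yd ud f : L} {lam : ℝ} {y : V} {u : L} {p : V}
    (h : E.System yd ud f lam y u p) (hlam : 0 < lam) : u = ud - (1 / lam) • E.toFn p := by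
  rw [eq_neg_of_add_eq_zero_left h.control, smul_neg, smul_smul, one_div,
    inv_mul_cancel₀ hlam.ne', one_smul]
  abel

variable {E} in
/-- The cost functional grows quadratically away from a solution of the optimality system. -/
theorem System.cost_eq {yd ud f : L} {lam : ℝ} {y : V} {u : L} {p : V}
    (h : E.System yd ud f lam y u p) {z : V} {v : L} (hz : E.IsSol (f + v) z) :
    E.cost yd ud lam z v = E.cost yd ud lam y u
      + (1 / 2 * ‖E.toFn (z - y)‖ ^ 2 + lam / 2 * ‖v - u‖ ^ 2) := by
  -- Duality: the adjoint equation tested with `z - y` and the difference of the states tested with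
  -- `p` have the same energy. With the control equation the first-order terms of the cost then
  -- cancel.
  have h1 : inner ℝ (E.toFn y - yd) (E.toFn (z - y)) = inner ℝ (v - u) (E.toFn p) := by
    rw [← h.adjoint, E.energy_symm, hz.sub h.state p, add_sub_add_left_eq_sub]
  have h2 : E.toFn p = -(lam • (u - ud)) := eq_neg_of_add_eq_zero_left h.control
  rw [h2, inner_neg_right, real_inner_smul_right,
    real_inner_comm (u - ud) (v - u)] at h1
  have e1 : E.toFn z - yd = (E.toFn y - yd) + E.toFn (z - y) := by rw [map_sub]; abel
  have e2 : v - ud = (u - ud) + (v - u) := by abel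
  rw [cost, cost, e1, e2, norm_add_sq_real, norm_add_sq_real, h1]
  ring

variable {E} in
theorem System.cost_le {yd ud f : L} {lam : ℝ} (hlam : 0 < lam) {y : V} {u : L} {p : V}
    (h : E.System yd ud f lam y u p) {z : V} {v : L} (hz : E.IsSol (f + v) z) :
    E.cost yd ud lam y u ≤ E.cost yd ud lam z v := by
  rw [h.cost_eq hz]
  exact le_add_of_nonneg_right (by positivity)

variable {E} in
theorem System.eq_of_cost_le {yd ud f : L} {lam : ℝ} (hlam : 0 < lam) {y : V} {u : L} {p : V}
    (h : E.System yd ud f lam y u p) {z : V} {v : L} (hz : E.IsSol (f + v) z)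
    (hle : E.cost yd ud lam z v ≤ E.cost yd ud lam y u) : z = y ∧ v = u := by
  rw [h.cost_eq hz] at hle
  have h1 : lam / 2 * ‖v - u‖ ^ 2 ≤ 0 := by nlinarith [sq_nonneg ‖E.toFn (z - y)‖]
  have h2 : ‖v - u‖ ^ 2 ≤ 0 := by
    by_contra! h3
    exact absurd h1 (not_le.2 (mul_pos (half_pos hlam) h3))
  have h3 : v = u := by
    rw [← sub_eq_zero, ← norm_eq_zero]
    exact pow_eq_zero_iff two_ne_zero |>.1 (le_antisymm h2 (sq_nonneg _))
  subst h3
  exact ⟨hz.unique h.state, rfl⟩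

variable {E} in
-- Each solution is a minimiser, so the costs agree and quadratic growth identifies state and
-- control; the adjoint equation then fixes `p`.
theorem System.unique {yd ud f : L} {lam : ℝ} (hlam : 0 < lam) {y y' : V} {u u' : L} {p p' : V}
    (h : E.System yd ud f lam y u p) (h' : E.System yd ud f lam y' u' p') :
    y' = y ∧ u' = u ∧ p' = p := by
  obtain ⟨rfl, rfl⟩ := h.eq_of_cost_le hlam h'.state (h'.cost_le hlam h.state)
  exact ⟨rfl, rfl, h'.adjoint.unique h.adjoint⟩

/-- Young's inequality with a parameter. -/
theorem add_sq_le_young (a b : ℝ) {α : ℝ} (hα : 0 < α) :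
    (a + b) ^ 2 ≤ (1 + α) * a ^ 2 + (1 + α) / α * b ^ 2 := by
  have h : (1 + α) * a ^ 2 + (1 + α) / α * b ^ 2 - (a + b) ^ 2 = (α * a - b) ^ 2 / α := by
    field_simp
    ring
  have : 0 ≤ (α * a - b) ^ 2 / α := by positivity
  linarith

/-- The majorant bounds the cost of the control `ud - ζ / λ`. -/
theorem cost_le_majorant {yd ud f : L} {lam α β : ℝ} (hlam : 0 < lam) (hα : 0 < α) (hβ : 0 < β)
    {η ζ z : V} {t : G} {q : L} (ht : E.IsDiv t q)
    (hz : E.IsSol (f + (ud - (1 / lam) • E.toFn ζ)) z) :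
    E.cost yd ud lam z (ud - (1 / lam) • E.toFn ζ) ≤ E.majorant yd ud f lam α β η ζ t q := by
  have h1 := E.grad_le_of_residual (hz.residual ht η)
  rw [← add_sub_assoc] at h1
  rw [cost, majorant]
  set r := ‖f + ud - (1 / lam) • E.toFn ζ + q‖
  set s := ‖t - E.coeff (E.grad η)‖
  have h2 : ‖E.toFn (z - η)‖ ≤ E.CF / E.lo * (s + E.CF * r) := by
    refine (E.friedrichs _).trans ?_
    rw [div_mul_eq_mul_div, le_div_iff₀ E.lo_pos, mul_assoc]
    refine mul_le_mul_of_nonneg_left ?_ E.CF_pos.le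
    linarith
  -- `β` separates the flux residual from the equilibrium residual; `α` below separates the
  -- computable misfit from the state error.
  have h3 : ‖E.toFn (z - η)‖ ^ 2 ≤ E.CF ^ 2 / E.lo ^ 2
      * ((1 + β) * s ^ 2 + (1 + β) / β * (E.CF * r) ^ 2) := by
    refine (pow_le_pow_left₀ (norm_nonneg _) h2 2).trans ?_
    rw [mul_pow, div_pow]
    exact mul_le_mul_of_nonneg_left (add_sq_le_young _ _ hβ) (by positivity)
  have h4 : ‖E.toFn z - yd‖ ^ 2
      ≤ (1 + α) * ‖E.toFn η - yd‖ ^ 2 + (1 + α) / α * ‖E.toFn (z - η)‖ ^ 2 := by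
    refine (pow_le_pow_left₀ (norm_nonneg _) ?_ 2).trans (add_sq_le_young _ _ hα)
    rw [show E.toFn z - yd = (E.toFn η - yd) + E.toFn (z - η) by rw [map_sub]; abel]
    exact norm_add_le _ _
  have h5 : lam / 2 * ‖ud - (1 / lam) • E.toFn ζ - ud‖ ^ 2 = 1 / (2 * lam) * ‖E.toFn ζ‖ ^ 2 := by
    rw [sub_sub_cancel_left, norm_neg, norm_smul, mul_pow, Real.norm_eq_abs, sq_abs]
    field_simp
  have h6 : (1 + α) / α * ‖E.toFn (z - η)‖ ^ 2 ≤ (1 + α) / α * (E.CF ^ 2 / E.lo ^ 2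
      * ((1 + β) * s ^ 2 + (1 + β) / β * (E.CF * r) ^ 2)) :=
    mul_le_mul_of_nonneg_left h3 (by positivity)
  have hlo := E.lo_pos.ne'
  have h7 : (1 + α) * (1 + β) * E.CF ^ 2 / (2 * α * E.lo ^ 2) * s ^ 2
      + (1 + α) * (1 + β) * E.CF ^ 4 / (2 * α * β * E.lo ^ 2) * r ^ 2
      = 1 / 2 * ((1 + α) / α * (E.CF ^ 2 / E.lo ^ 2
      * ((1 + β) * s ^ 2 + (1 + β) / β * (E.CF * r) ^ 2))) := by
    field_simp
  rw [h5]
  linarith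

variable {E} in
/-- At the exact solution and its fluxes, majorant and minorant differ by `α / 2 ‖y - yd‖²`. -/
theorem System.majorant_sub_minorant {yd ud f : L} {lam : ℝ} (hlam : 0 < lam) {y : V} {u : L}
    {p : V} (h : E.System yd ud f lam y u p) (α β : ℝ) :
    E.majorant yd ud f lam α β y p (E.coeff (E.grad y)) (-(f + u))
      - E.minorant yd ud f lam y p (E.coeff (E.grad y)) (-(f + u)) (E.coeff (E.grad p))
        (-(E.toFn y - yd)) = α / 2 * ‖E.toFn y - yd‖ ^ 2 := by
  -- The quotients with `α` and `β` in the denominator multiply vanishing norms, so no sign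
  -- condition on them is needed.
  have h1 : f + ud - (1 / lam) • E.toFn p + -(f + u) = 0 := by
    rw [h.control_eq hlam]; abel
  simp only [majorant, minorant, h1, sub_self, add_neg_cancel, norm_zero, inner_zero_left]
  ring

/-! ### Solvability by Lax–Milgram -/

variable [CompleteSpace V] [CompleteSpace L]

/-- The continuous solution operator `r ↦ y`. -/
noncomputable def solve : L →L[ℝ] V :=
  (E.isCoercive_form.continuousLinearEquivOfBilin.symm : V →L[ℝ] V).comp E.toFn.adjoint

theorem isSol_solve (r : L) : E.IsSol r (E.solve r) := by
  intro w
  have h := E.isCoercive_form.continuousLinearEquivOfBilin_apply (E.solve r) w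
  rw [form_apply] at h
  rw [← h]
  simp [solve, ContinuousLinearMap.adjoint_inner_left]

/-- Both sides equal the energy product of the two solutions, so symmetry of the form makes the
control-to-state operator self-adjoint. -/
theorem inner_toFn_solve (r q : L) :
    inner ℝ (E.toFn (E.solve r)) q = inner ℝ r (E.toFn (E.solve q)) := by
  rw [real_inner_comm, ← E.isSol_solve q, ← E.isSol_solve r, E.energy_symm]

/-- Eliminating `y` and `p` leaves `(T² + λ) u = λ ud - T (T f - yd)`. As `T` is self-adjoint, `T²`
is nonnegative and the operator is coercive with constant `λ`. -/
theorem exists_system (yd ud f : L) {lam : ℝ} (hlam : 0 < lam) :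
    ∃ y u p, E.System yd ud f lam y u p := by
  let T : L →L[ℝ] L := E.toFn.comp E.solve
  have hT : ∀ r q, inner ℝ (T r) q = inner ℝ r (T q) := E.inner_toFn_solve
  let B : L →L[ℝ] L →L[ℝ] ℝ := (innerSL ℝ).comp (T.comp T + lam • ContinuousLinearMap.id ℝ L)
  have hBa : ∀ u w, B u w = inner ℝ (T (T u) + lam • u) w := fun _ _ => rfl
  have hB : IsCoercive B := by
    refine ⟨lam, hlam, fun u => ?_⟩
    rw [hBa, inner_add_left, hT, real_inner_smul_left, real_inner_self_eq_norm_sq,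
      real_inner_self_eq_norm_sq]
    nlinarith [sq_nonneg ‖T u‖]
  let g : L := lam • ud - T (T f - yd)
  let u : L := hB.continuousLinearEquivOfBilin.symm g
  have hu : T (T u) + lam • u = g := by
    refine ext_inner_right ℝ fun w => ?_
    rw [← hBa, ← hB.continuousLinearEquivOfBilin_apply, ContinuousLinearEquiv.apply_symm_apply]
  refine ⟨E.solve (f + u), u, E.solve (E.toFn (E.solve (f + u)) - yd),
    E.isSol_solve _, E.isSol_solve _, ?_⟩
  change T (T (f + u) - yd) + lam • (u - ud) = 0
  have : T (T (f + u) - yd) = T (T f - yd) + T (T u) := by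
    simp only [map_add, map_sub]; abel
  rw [this, smul_sub]
  simp only [g] at hu
  rw [eq_sub_iff_add_eq] at hu
  rw [← hu]; abel

/-! ### The lower bound and its consequences -/

variable {E} in
/-- The minorant bounds the optimal cost. -/
theorem System.minorant_le_cost {yd ud f : L} {lam : ℝ} (hlam : 0 < lam) {y : V} {u : L} {p : V}
    (h : E.System yd ud f lam y u p) (η ζ : V) {t : G} {q : L} (ht : E.IsDiv t q)
    {t' : G} {q' : L} (ht' : E.IsDiv t' q') :
    E.minorant yd ud f lam η ζ t q t' q' ≤ E.cost yd ud lam y u := by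
  -- The exact control is not `ud - ζ/λ`, so the state residual contains the adjoint error, and by
  -- `hR` the adjoint residual contains the state error: the two error equations are coupled.
  have hr : f + u + q
      = (f + ud - (1 / lam) • E.toFn ζ + q) - (1 / lam) • E.toFn (p - ζ) := by
    rw [h.control_eq hlam, map_sub, smul_sub]; abel
  have hR : E.toFn y - yd + q' = (E.toFn η - yd + q') + E.toFn (y - η) := by
    rw [map_sub]; abel
  have hy := h.state.residual ht η
  have hp := h.adjoint.residual ht' ζ
  rw [hr] at hy
  rw [hR] at hp
  rw [minorant]
  set r := f + ud - (1 / lam) • E.toFn ζ + q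
  set s := t - E.coeff (E.grad η)
  set R := E.toFn η - yd + q'
  set S := t' - E.coeff (E.grad ζ)
  set e := y - η
  set A := E.CF * ‖R‖ + ‖S‖
  -- `X` is the second factor of the product in the minorant; it will bound `lo * ‖∇e‖`.
  set X := E.CF ^ 2 / (lam * E.lo) * A + (E.CF * ‖r‖ + ‖s‖) with hX
  have hCF := E.CF_pos
  have hlo := E.lo_pos
  have hA : 0 ≤ A := by positivity
  -- split the adjoint error into the part driven by `e` and the part driven by the residuals
  obtain ⟨q₀, hq₀⟩ : ∃ q₀, E.IsSol (E.toFn e) q₀ := ⟨_, E.isSol_solve _⟩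
  have hq₁ : E.lo * ‖E.grad (p - ζ - q₀)‖ ≤ A := by
    refine E.grad_le_of_residual fun w => ?_
    rw [map_sub E.grad (p - ζ), map_sub E.coeff, inner_sub_left, hp, hq₀ w, inner_add_left]
    ring
  have he : E.lo * ‖E.grad e‖ ≤ X := by
    refine E.grad_le ?_ (by positivity)
    -- This pairing is the energy of `q₀`. It enters the estimate of `e` with a favourable sign and
    -- is dropped, which decouples the two error equations.
    have h0 : 0 ≤ inner ℝ (E.toFn q₀) (E.toFn e) := by
      rw [real_inner_comm, ← hq₀ q₀]
      exact le_trans (by positivity) (E.coercive _)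
    have h1 : -inner ℝ (E.toFn (p - ζ - q₀)) (E.toFn e)
        ≤ E.CF ^ 2 / E.lo * A * ‖E.grad e‖ := by
      refine (neg_le_abs _).trans ((abs_real_inner_le_norm _ _).trans ?_)
      calc _ ≤ (E.CF * ‖E.grad (p - ζ - q₀)‖) * (E.CF * ‖E.grad e‖) :=
            mul_le_mul (E.friedrichs _) (E.friedrichs _) (norm_nonneg _) (by positivity)
        _ = E.CF ^ 2 / E.lo * (E.lo * ‖E.grad (p - ζ - q₀)‖) * ‖E.grad e‖ := by
            field_simp
        _ ≤ _ := by gcongr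
    have h2 : inner ℝ (E.toFn (p - ζ)) (E.toFn e)
        = inner ℝ (E.toFn q₀) (E.toFn e) + inner ℝ (E.toFn (p - ζ - q₀)) (E.toFn e) := by
      rw [← inner_add_left, ← map_add]; congr 2; abel
    have h3 : -inner ℝ (E.toFn (p - ζ)) (E.toFn e) ≤ E.CF ^ 2 / E.lo * A * ‖E.grad e‖ := by
      linarith
    have h4 := mul_le_mul_of_nonneg_left h3 (one_div_pos.2 hlam).le
    have h5 : 1 / lam * (E.CF ^ 2 / E.lo * A * ‖E.grad e‖)
        = E.CF ^ 2 / (lam * E.lo) * A * ‖E.grad e‖ := by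
      field_simp
    have h6 := E.pairing_le r s e
    rw [hy e, inner_sub_left, real_inner_smul_left, hX, add_mul]
    linarith
  have hprod : A * ‖E.grad e‖ ≤ 1 / E.lo * A * X := by
    calc A * ‖E.grad e‖ = 1 / E.lo * A * (E.lo * ‖E.grad e‖) := by field_simp
      _ ≤ _ := by gcongr
  have hXe : E.CF ^ 3 / (lam * E.lo) * ‖R‖ + E.CF ^ 2 / (lam * E.lo) * ‖S‖ + E.CF * ‖r‖ + ‖s‖
      = X := by
    rw [hX]; ring
  -- The bracket equals `(R, e) + (S, ∇e)`, because the contributions of the auxiliary flux `t'` and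
  -- its divergence cancel.
  have hres : -(inner ℝ (E.toFn η - yd) (E.toFn e) - inner ℝ (E.coeff (E.grad e)) (E.grad ζ))
      ≤ A * ‖E.grad e‖ := by
    have h1 := E.pairing_le (-R) (-S) e
    have h2 : inner ℝ R (E.toFn e) = inner ℝ (E.toFn η - yd) (E.toFn e) + inner ℝ q' (E.toFn e) :=
      inner_add_left _ _ _
    have h3 : inner ℝ S (E.grad e)
        = -inner ℝ q' (E.toFn e) - inner ℝ (E.coeff (E.grad e)) (E.grad ζ) := by
      rw [inner_sub_left, ht' e, E.energy_symm ζ e]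
    rw [norm_neg, norm_neg, inner_neg_left, inner_neg_left] at h1
    linarith
  have h5 : lam / 2 * ‖u - ud‖ ^ 2 = 1 / (2 * lam) * ‖E.toFn p‖ ^ 2 := by
    rw [h.control_eq hlam, sub_sub_cancel_left, norm_neg, norm_smul, mul_pow, Real.norm_eq_abs,
      sq_abs]
    field_simp
  have h6 : ‖E.toFn p‖ ^ 2 = ‖E.toFn ζ‖ ^ 2 + 2 * inner ℝ (E.toFn (p - ζ)) (E.toFn ζ)
      + ‖E.toFn (p - ζ)‖ ^ 2 := by
    rw [real_inner_comm, ← norm_add_sq_real, ← map_add, add_sub_cancel]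
  have h7 : ‖E.toFn y - yd‖ ^ 2 = ‖E.toFn η - yd‖ ^ 2
      + 2 * inner ℝ (E.toFn η - yd) (E.toFn e) + ‖E.toFn e‖ ^ 2 := by
    rw [← norm_add_sq_real]; congr 2; simp only [e, map_sub]; abel
  -- Testing the state error equation with `ζ` trades the cross term `(p - ζ, ζ)/λ` for the
  -- computable terms in `r` and `s`, minus the energy product of `e` and `ζ` estimated in `hres`.
  have h8 := hy ζ
  rw [inner_sub_left, real_inner_smul_left] at h8
  have h9 : 1 / (2 * lam) * ‖E.toFn p‖ ^ 2 = 1 / (2 * lam) * ‖E.toFn ζ‖ ^ 2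
      + 1 / lam * inner ℝ (E.toFn (p - ζ)) (E.toFn ζ)
      + 1 / (2 * lam) * ‖E.toFn (p - ζ)‖ ^ 2 := by
    rw [h6]; field_simp
  have h10 : 0 ≤ 1 / (2 * lam) * ‖E.toFn (p - ζ)‖ ^ 2 := by positivity
  rw [hXe, cost, h5, h7, h9]
  linarith [sq_nonneg ‖E.toFn e‖]

theorem majorant_sub_minorant_nonneg (yd ud f : L) {lam α β : ℝ} (hlam : 0 < lam) (hα : 0 < α)
    (hβ : 0 < β) (η ζ : V) {t : G} {q : L} (ht : E.IsDiv t q) {t' : G} {q' : L}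
    (ht' : E.IsDiv t' q') :
    0 ≤ E.majorant yd ud f lam α β η ζ t q - E.minorant yd ud f lam η ζ t q t' q' := by
  obtain ⟨y, u, p, h⟩ := E.exists_system yd ud f hlam
  have hz := E.isSol_solve (f + (ud - (1 / lam) • E.toFn ζ))
  exact sub_nonneg.2 ((h.minorant_le_cost hlam η ζ ht ht').trans
    ((h.cost_le hlam hz).trans (E.cost_le_majorant hlam hα hβ ht hz)))

theorem system_existsUnique (yd ud f : L) {lam : ℝ} (hlam : 0 < lam) :
    ∃! s : V × L × V, E.System yd ud f lam s.1 s.2.1 s.2.2 := by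
  obtain ⟨y, u, p, h⟩ := E.exists_system yd ud f hlam
  refine ⟨(y, u, p), h, fun s hs => ?_⟩
  obtain ⟨h1, h2, h3⟩ := h.unique hlam hs
  exact Prod.ext h1 (Prod.ext h2 h3)

/-- Necessity needs no differentiation of the cost: an optimal pair costs no more than the system's
solution, so quadratic growth makes them equal. -/
theorem optimal_iff_system (yd ud f : L) {lam : ℝ} (hlam : 0 < lam) (y : V) (u : L) :
    (E.IsSol (f + u) y ∧ ∀ z v, E.IsSol (f + v) z →
      E.cost yd ud lam y u ≤ E.cost yd ud lam z v) ↔ ∃ p, E.System yd ud f lam y u p := by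
  constructor
  · rintro ⟨h1, h2⟩
    obtain ⟨y', u', p, h⟩ := E.exists_system yd ud f hlam
    obtain ⟨rfl, rfl⟩ := h.eq_of_cost_le hlam h1 (h2 _ _ h.state)
    exact ⟨p, h⟩
  · rintro ⟨p, h⟩
    exact ⟨h.state, fun z v hz => h.cost_le hlam hz⟩

end EllipticTriple

/-! ### Realisation in `H¹₀(Ω)`, `L²(Ω)` and `H(div,Ω)` -/

variable {d : ℕ} {Ω : Set (Space d)} {ν : Space d → ℝ} {νlo νhi : ℝ}

theorem coeFn_flux (hν : IsDiffusion Ω ν νlo νhi) (g : L2Vec Ω) :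
    flux hν g =ᵐ[volume.restrict Ω] fun x => ν x • g x :=
  (hν.memLp_smul g).coeFn_toLp

/-- Multiplication by `ν` as a continuous linear map on `[L²(Ω)]^d`. -/
noncomputable def fluxL (hν : IsDiffusion Ω ν νlo νhi) : L2Vec Ω →L[ℝ] L2Vec Ω :=
  LinearMap.mkContinuous
    { toFun := flux hν
      map_add' := fun g h => by
        refine Lp.ext ?_
        filter_upwards [coeFn_flux hν (g + h), Lp.coeFn_add g h,
          Lp.coeFn_add (flux hν g) (flux hν h), coeFn_flux hν g, coeFn_flux hν h]
          with x h1 h2 h3 h4 h5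
        rw [h1, h3, h2, Pi.add_apply, Pi.add_apply, h4, h5, smul_add]
      map_smul' := fun c g => by
        refine Lp.ext ?_
        filter_upwards [coeFn_flux hν (c • g), Lp.coeFn_smul c g,
          Lp.coeFn_smul c (flux hν g), coeFn_flux hν g] with x h1 h2 h3 h4
        rw [RingHom.id_apply, h1, h3, h2, Pi.smul_apply, Pi.smul_apply, h4, smul_comm] }
    νhi fun g => by
      refine Lp.norm_le_mul_norm_of_ae_le_mul ?_
      filter_upwards [coeFn_flux hν g, hν.lower, hν.upper] with x h1 h2 h3
      change ‖flux hν g x‖ ≤ _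
      rw [h1, norm_smul, Real.norm_eq_abs, abs_of_nonneg (hν.pos.le.trans h2)]
      gcongr

theorem inner_flux_comm (hν : IsDiffusion Ω ν νlo νhi) (g h : L2Vec Ω) :
    inner ℝ (flux hν g) h = inner ℝ g (flux hν h) := by
  rw [L2.inner_def, L2.inner_def]
  refine integral_congr_ae ?_
  filter_upwards [coeFn_flux hν g, coeFn_flux hν h] with x h1 h2
  rw [h1, h2, real_inner_smul_left, real_inner_smul_right]

theorem flux_coercive (hν : IsDiffusion Ω ν νlo νhi) (g : L2Vec Ω) :
    νlo * ‖g‖ ^ 2 ≤ inner ℝ (flux hν g) g := by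
  rw [← real_inner_self_eq_norm_sq, L2.inner_def, L2.inner_def, ← integral_const_mul]
  refine integral_mono_ae ((L2.integrable_inner g g).const_mul _)
    (L2.integrable_inner (flux hν g) g) ?_
  filter_upwards [coeFn_flux hν g, hν.lower] with x h1 h2
  rw [h1, real_inner_smul_left]
  exact mul_le_mul_of_nonneg_right h2 real_inner_self_nonneg

theorem isClosed_h10Submodule (Ω : Set (Space d)) :
    IsClosed (h10Submodule Ω : Set (WithLp 2 (L2 Ω × L2Vec Ω))) :=
  (testPairs Ω).isClosed_topologicalClosure

instance : CompleteSpace (H10 Ω) :=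
  (isClosed_h10Submodule Ω).completeSpace_coe

/-- The elliptic problem on `H¹₀(Ω)` with diffusion coefficient `ν`. -/
noncomputable def diffusionTriple (hν : IsDiffusion Ω ν νlo νhi) {CF : ℝ}
    (hCF : IsFriedrichsConstant Ω CF) : EllipticTriple (H10 Ω) (L2 Ω) (L2Vec Ω) where
  toFn := (WithLp.fstL 2 ℝ (L2 Ω) (L2Vec Ω)).comp (h10Submodule Ω).subtypeL
  grad := (WithLp.sndL 2 ℝ (L2 Ω) (L2Vec Ω)).comp (h10Submodule Ω).subtypeL
  coeff := fluxL hν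
  lo := νlo
  CF := CF
  lo_pos := hν.pos
  CF_pos := hCF.1
  symm := inner_flux_comm hν
  coercive := flux_coercive hν
  friedrichs := hCF.2
  norm_sq := fun w => WithLp.prod_norm_sq_eq_of_L2 w.1

/-- Green's formula on `H¹₀(Ω) × H(div,Ω)`. -/
theorem Hdiv.inner_grad (τ : Hdiv Ω) (w : H10 Ω) :
    inner ℝ τ.field w.grad = -inner ℝ τ.div w.fn := by
  have hcl : IsClosed {z : WithLp 2 (L2 Ω × L2Vec Ω) |
      inner ℝ τ.field z.snd = -inner ℝ τ.div z.fst} :=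
    isClosed_eq (continuous_const.inner (continuous_grad Ω))
      (continuous_const.inner (continuous_fn Ω)).neg
  -- Density: the identity is a closed condition, and on test functions it is the definition of the
  -- weak divergence.
  refine closure_minimal ?_ hcl w.2
  rintro z ⟨φ, hφ, h1, h2⟩
  have h := τ.2 φ hφ
  change inner ℝ τ.field z.snd = -inner ℝ τ.div z.fst
  rw [L2.inner_def, L2.inner_def]
  refine Eq.trans (integral_congr_ae ?_) (h.trans (congrArg _ (integral_congr_ae ?_)))
  · filter_upwards [h2] with x hx
    rw [hx]; rfl
  · filter_upwards [h1] with x hx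
    rw [hx, real_inner_comm]; rfl

theorem IsTestFunction.continuous_gradient {φ : Space d → ℝ} (hφ : IsTestFunction Ω φ) :
    Continuous (gradient φ) :=
  (LinearIsometryEquiv.continuous _).comp (hφ.smooth.continuous_fderiv (by simp))

theorem IsTestFunction.compact_gradient {φ : Space d → ℝ} (hφ : IsTestFunction Ω φ) :
    HasCompactSupport (gradient φ) :=
  (hφ.compact.fderiv (𝕜 := ℝ)).comp_left
    (g := (InnerProductSpace.toDual ℝ (Space d)).symm) (map_zero _)

/-- A test function as an element of `H¹₀(Ω)`. -/
theorem IsTestFunction.exists_h10 {φ : Space d → ℝ} (hφ : IsTestFunction Ω φ) :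
    ∃ w : H10 Ω, w.fn =ᵐ[volume.restrict Ω] φ ∧ w.grad =ᵐ[volume.restrict Ω] gradient φ := by
  have hA : MemLp φ 2 (volume.restrict Ω) :=
    hφ.smooth.continuous.memLp_of_hasCompactSupport hφ.compact
  have hB : MemLp (gradient φ) 2 (volume.restrict Ω) :=
    hφ.continuous_gradient.memLp_of_hasCompactSupport hφ.compact_gradient
  exact ⟨⟨WithLp.toLp 2 (hA.toLp, hB.toLp), (testPairs Ω).le_topologicalClosure
    ⟨φ, hφ, hA.coeFn_toLp, hB.coeFn_toLp⟩⟩, hA.coeFn_toLp, hB.coeFn_toLp⟩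

/-- The flux of a weak solution has a weak divergence. -/
theorem IsWeakSolution.isWeakDivergence {hν : IsDiffusion Ω ν νlo νhi} {r : L2 Ω} {y : H10 Ω}
    (h : IsWeakSolution hν r y) : IsWeakDivergence Ω (flux hν y.grad) (-r) := by
  intro φ hφ
  obtain ⟨w, h1, h2⟩ := hφ.exists_h10
  have e1 : ∫ x in Ω, inner ℝ (flux hν y.grad x) (gradient φ x)
      = inner ℝ (flux hν y.grad) w.grad := by
    rw [L2.inner_def]
    refine integral_congr_ae ?_
    filter_upwards [h2] with x hx
    rw [hx]
  have e2 : -∫ x in Ω, (-r : L2 Ω) x * φ x = inner ℝ r w.fn := by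
    rw [L2.inner_def, ← integral_neg]
    refine integral_congr_ae ?_
    filter_upwards [h1, Lp.coeFn_neg r] with x hx hr
    rw [hx, hr, real_inner_comm]
    simp
  rw [e1, e2, h w]

theorem solvesOptimalitySystem_iff (hν : IsDiffusion Ω ν νlo νhi) {CF : ℝ}
    (hCF : IsFriedrichsConstant Ω CF) (yd ud f : L2 Ω) (lam : ℝ) (y : H10 Ω) (u : L2 Ω)
    (p : H10 Ω) : SolvesOptimalitySystem hν yd ud f lam y u p ↔
      (diffusionTriple hν hCF).System yd ud f lam y u p :=
  ⟨fun h => ⟨h.state, h.adjoint, h.control⟩, fun h => ⟨h.state, h.adjoint, h.control⟩⟩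

theorem errorMajorant_nonneg (hν : IsDiffusion Ω ν νlo νhi) {CF : ℝ}
    (hCF : IsFriedrichsConstant Ω CF) (yd ud f : L2 Ω) {lam α β : ℝ} (hlam : 0 < lam)
    (hα : 0 < α) (hβ : 0 < β) (η ζ : H10 Ω) (τ ρ : Hdiv Ω) :
    0 ≤ errorMajorant hν CF yd ud f lam α β η ζ τ ρ :=
  (diffusionTriple hν hCF).majorant_sub_minorant_nonneg yd ud f hlam hα hβ η ζ
    τ.inner_grad ρ.inner_grad

/-- At the exact solution and its fluxes, the error majorant is `α / 2 ‖y - yd‖²`. -/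
theorem SolvesOptimalitySystem.exists_fluxes {hν : IsDiffusion Ω ν νlo νhi} {CF : ℝ}
    (hCF : IsFriedrichsConstant Ω CF) {yd ud f : L2 Ω} {lam : ℝ} (hlam : 0 < lam) {y : H10 Ω}
    {u : L2 Ω} {p : H10 Ω} (h : SolvesOptimalitySystem hν yd ud f lam y u p) :
    ∃ τ ρ : Hdiv Ω, τ.field = flux hν y.grad ∧ ρ.field = flux hν p.grad ∧
      ∀ α β : ℝ, errorMajorant hν CF yd ud f lam α β y p τ ρ = α / 2 * ‖y.fn - yd‖ ^ 2 :=
  ⟨⟨(_, _), h.state.isWeakDivergence⟩, ⟨(_, _), h.adjoint.isWeakDivergence⟩, rfl, rfl,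
    ((solvesOptimalitySystem_iff hν hCF yd ud f lam y u p).1 h).majorant_sub_minorant hlam⟩

theorem tendsto_half_mul_nhdsGT (c : ℝ) : Tendsto (fun α : ℝ => α / 2 * c) (𝓝[>] 0) (𝓝 0) := by
  have : Continuous fun α : ℝ => α / 2 * c := by fun_prop
  simpa using (this.tendsto 0).mono_left nhdsWithin_le_nhds

end EllipticControl

/-! ### The main theorem -/

open EllipticControl in
theorem mainTheorem11 {d : ℕ} (hd : 1 ≤ d) {Ω : Set (Space d)}
    (hΩ : IsOpen Ω) (hΩb : Bornology.IsBounded Ω)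
    {ν : Space d → ℝ} {νlo νhi : ℝ} (hν : IsDiffusion Ω ν νlo νhi)
    {CF : ℝ} (hCF : IsFriedrichsConstant Ω CF)
    (yd ud f : L2 Ω) {lam : ℝ} (hlam : 0 < lam) :
    -- the infimum of the majorant is zero
    IsGLB {m : ℝ | ∃ (α β : ℝ) (η ζ : H10 Ω) (τ ρ : Hdiv Ω), 0 < α ∧ 0 < β ∧
        m = errorMajorant hν CF yd ud f lam α β η ζ τ ρ} 0 ∧
    -- the exact solution exists, is unique, and solves the control problem, equivalently the system
    (∃! s : H10 Ω × L2 Ω × H10 Ω,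
        SolvesOptimalitySystem hν yd ud f lam s.1 s.2.1 s.2.2) ∧
    (∀ (y : H10 Ω) (u : L2 Ω), IsOptimal hν yd ud f lam y u ↔
        ∃ p : H10 Ω, SolvesOptimalitySystem hν yd ud f lam y u p) ∧
    -- at the exact solution and its fluxes the infimum is approached as `α → 0`
    (∀ (y : H10 Ω) (u : L2 Ω) (p : H10 Ω), SolvesOptimalitySystem hν yd ud f lam y u p →
        u = ud - (1 / lam) • p.fn ∧
        ∃ τ ρ : Hdiv Ω, τ.field = flux hν y.grad ∧ ρ.field = flux hν p.grad ∧
          ∀ β : ℝ, 0 < β →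
            Tendsto (fun α : ℝ => errorMajorant hν CF yd ud f lam α β y p τ ρ)
              (𝓝[>] 0) (𝓝 0)) := by
  have hsys := solvesOptimalitySystem_iff hν hCF yd ud f lam
  have hex := (diffusionTriple hν hCF).system_existsUnique yd ud f hlam
  refine ⟨⟨?_, ?_⟩, ?_, fun y u => ?_, fun y u p h => ?_⟩
  · rintro m ⟨α, β, η, ζ, τ, ρ, hα, hβ, rfl⟩
    exact errorMajorant_nonneg hν hCF yd ud f hlam hα hβ η ζ τ ρ
  · intro b hb
    obtain ⟨s, hs, -⟩ := hex
    obtain ⟨τ, ρ, -, -, h⟩ := ((hsys _ _ _).2 hs).exists_fluxes hCF hlam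
    -- A lower bound lies below `α/2 ‖y - yd‖²` for every `α > 0`, hence below its limit zero. The
    -- value at the exact fluxes does not depend on `β`, so `β = 1` serves.
    refine ge_of_tendsto (tendsto_half_mul_nhdsGT (‖s.1.fn - yd‖ ^ 2)) ?_
    filter_upwards [self_mem_nhdsWithin] with α hα
    exact hb ⟨α, 1, s.1, s.2.2, τ, ρ, hα, one_pos, (h α 1).symm⟩
  · simpa only [hsys] using hex
  · simp only [hsys]
    exact (diffusionTriple hν hCF).optimal_iff_system yd ud f hlam y u
  · refine ⟨((hsys y u p).1 h).control_eq hlam, ?_⟩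
    obtain ⟨τ, ρ, h1, h2, h3⟩ := h.exists_fluxes hCF hlam
    refine ⟨τ, ρ, h1, h2, fun β _ => ?_⟩
    simp only [h3]
    exact tendsto_half_mul_nhdsGT _
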